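/- For each integer $N\ge 1$ let $\mathbf{SP}(N)$ be the spider with $N$ legs: the graph formed by $N$ half-lines (legs) with vertices $v_N(r,j)$, $r=0,1,2,\dots$, $1\le j\le N$, in which $v_N(r,j)$ is joined to $v_N(r+1,j)$ and the vertices $v_N(0,1)=\dots=v_N(0,N)=:v_N(0)$ (the body) are identified. Let $(\mathbf S_n)_{n\ge 0}$ be the random walk (Markov chain) on $\mathbf{SP}(N)$ with $\mathbf S_0=v_N(0)$ which from the body steps to $v_N(1,j)$ with probability $1/N$ for each $j=1,\dots,N$, and from $v_N(r,j)$ with $r\ge 1$ steps to $v_N(r+1,j)$ or to $v_N(r-1,j)$ with probability $1/2$ each. For integers $n\ge 0$ and $L\ge 1$ let $M(n,L)$ be the event that for every leg $j$ there is a $k\le n$ with $\mathbf S_k=v_N(L,j)$, i.e. that in $n$ steps the walk reaches height $L$ on each of the $N$ legs. Let $L=L(N)$ be integers with $1\le L(N)\le N/\log N$ for all sufficiently large $N$, and let $f(N)$ be any real sequence that decreases (not necessarily strictly) to $0$ as $N\to\infty$. Then $$\lim_{N\to\infty}\mathbf P\Big(M\big(\big[(f(N)\,L(N)\,N\log N)^2\big],\,L(N)\big)\Big)=0,$$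 where $[\cdot]$ denotes the integer part. -/

import Mathlib

open Filter Topology MeasureTheory

/-- The vertex set of the spider with `N` legs: the body, and on every leg `j` one vertex at each
height `1, 2, 3, …`; `node j r` is the vertex of leg `j` at height `r + 1`. -/
inductive Spider (N : ℕ) where
  | body : Spider N
  | node (j : Fin N) (r : ℕ) : Spider N
  deriving DecidableEq

namespace Spider

/-- The spider is a countable discrete space: every set of vertices is measurable. -/
instance (N : ℕ) : MeasurableSpace (Spider N) := ⊤

/-- The vertex `v_N(r, j)` at height `r` on leg `j`. The height `0` vertices of all legs are the
same vertex, the body. -/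
def vertex {N : ℕ} (r : ℕ) (j : Fin N) : Spider N :=
  match r with
  | 0 => body
  | r + 1 => node j r

/-- One-step transition probabilities of the walk on the spider: from the body the walk steps to
height `1` on leg `j` with probability `p j`; from height `r ≥ 1` on leg `j` it steps to height
`r + 1` or `r - 1` on the same leg, with probability `1 / 2` each. -/
noncomputable def transition {N : ℕ} (p : Fin N → ℝ) : Spider N → Spider N → ℝ
  | body, w => ∑ j, if w = vertex 1 j then p j else 0
  | node j r, w => if w = vertex (r + 2) j ∨ w = vertex r j then 1 / 2 else 0

/-- `S` is a random walk on the spider, started at the body, with leg probabilities `p`: a Markov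
chain with the transition probabilities above. The Markov property
`P(S_{n+1} = x_{n+1} | S_0 = x_0, …, S_n = x_n) = transition p x_n x_{n+1}`
is written multiplied out. -/
structure IsWalk {N : ℕ} {Ω : Type*} [MeasurableSpace Ω] (μ : Measure Ω) (p : Fin N → ℝ)
    (S : ℕ → Ω → Spider N) : Prop where
  measurable : ∀ n, Measurable (S n)
  start : ∀ᵐ ω ∂μ, S 0 ω = body
  markov : ∀ (n : ℕ) (x : ℕ → Spider N),
    μ.real {ω | ∀ k ≤ n + 1, S k ω = x k} =
      μ.real {ω | ∀ k ≤ n, S k ω = x k} * transition p (x n) (x (n + 1))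

/-- The local time `ξ(v, n)`: the number of times `k ≤ n` at which the walk is at `v`. -/
def localTime {N : ℕ} {Ω : Type*} (S : ℕ → Ω → Spider N) (v : Spider N) (n : ℕ) (ω : Ω) : ℕ :=
  ((Finset.range (n + 1)).filter (fun k => S k ω = v)).card

/-- The event `M(n, L)`: in `n` steps the walk visits height `L` on every leg at least once. -/
def reachAll {N : ℕ} {Ω : Type*} (S : ℕ → Ω → Spider N) (n L : ℕ) : Set Ω :=
  {ω | ∀ j : Fin N, 1 ≤ localTime S (vertex L j) n ω}

end Spider

namespace Spider

open scoped ENNReal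

variable {N : ℕ}

/-! Collecting the vertices at height `L` is a coupon collector problem in which an excursion from
the body succeeds with probability `1 / L`. It is run in real time by a potential that counts the
coupon mean already earned, plus the expected gain of the current excursion. Its one-step drift is
at most `1 / L` at the body and at most zero elsewhere (`stepMean_potential_le`), and collecting a
leg leaves it unchanged (`potential_addVisited`).

The height has drift one at the body and zero elsewhere, so the mean potential at time `n` is at
most the mean height over `L`, hence at most `√n / L`. Once all legs are collected the potential is
at least `N * harmonic N`, and Markov's inequality gives `mul_measureReal_reachAll_le`. For the
stated `n` this bounds the probability by `f N`. -/

instance (N : ℕ) : DiscreteMeasurableSpace (Spider N) := ⟨fun _ => trivial⟩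

instance (N : ℕ) : Countable (Spider N) := by
  refine Function.Injective.countable (β := Option (Fin N × ℕ))
    (f := fun x => match x with
      | body => none
      | node j r => some (j, r)) ?_
  rintro (_ | ⟨j, r⟩) (_ | ⟨i, s⟩) h <;> simp_all

/-- The height of a vertex, i.e. its distance from the body. -/
def height : Spider N → ℕ
  | body => 0
  | node _ r => r + 1

@[simp] lemma height_body : height (body : Spider N) = 0 := rfl

@[simp] lemma height_node (j : Fin N) (r : ℕ) : height (node j r) = r + 1 := rfl

@[simp] lemma height_vertex (r : ℕ) (j : Fin N) : height (vertex r j) = r := by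
  cases r <;> rfl

lemma vertex_succ (r : ℕ) (j : Fin N) : vertex (r + 1) j = node j r := rfl

/-! ### One-step means and the Markov property -/

/-- The mean of a function of the position one step after the walk is at a given vertex. -/
noncomputable def stepMean (g : Spider N → ℝ) : Spider N → ℝ
  | body => ∑ j : Fin N, 1 / (N : ℝ) * g (vertex 1 j)
  | node j r => (g (vertex (r + 2) j) + g (vertex r j)) / 2

lemma tsum_transition_mul (g : Spider N → ℝ) (hg : ∀ y, 0 ≤ g y) (x : Spider N) :
    ∑' y, ENNReal.ofReal (transition (fun _ : Fin N => 1 / (N : ℝ)) x y) * ENNReal.ofReal (g y)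
      = ENNReal.ofReal (stepMean g x) := by
  cases x with
  | body =>
    have h : ∀ y : Spider N,
        ENNReal.ofReal (transition (fun _ : Fin N => 1 / (N : ℝ)) body y) * ENNReal.ofReal (g y)
          = ∑ j : Fin N, if y = vertex 1 j then ENNReal.ofReal (1 / (N : ℝ) * g (vertex 1 j))
            else 0 := by
      intro y
      rw [transition, ENNReal.ofReal_sum_of_nonneg (fun j _ => by split_ifs <;> positivity),
        Finset.sum_mul]
      refine Finset.sum_congr rfl fun j _ => ?_
      split_ifs with hy
      · rw [hy, ENNReal.ofReal_mul (by positivity)]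
      · simp
    simp_rw [h]
    rw [Summable.tsum_finsetSum (fun _ _ => ENNReal.summable)]
    simp_rw [tsum_ite_eq]
    rw [stepMean, ENNReal.ofReal_sum_of_nonneg
      (fun j _ => mul_nonneg (by positivity) (hg _))]
  | node j r =>
    have hne : vertex (r + 2) j ≠ vertex r j := fun h => by
      have := congrArg height h
      simp at this
    have h : ∀ y : Spider N,
        ENNReal.ofReal (transition (fun _ : Fin N => 1 / (N : ℝ)) (node j r) y)
            * ENNReal.ofReal (g y)
          = (if y = vertex (r + 2) j then ENNReal.ofReal (1 / 2 * g (vertex (r + 2) j)) else 0)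
            + if y = vertex r j then ENNReal.ofReal (1 / 2 * g (vertex r j)) else 0 := by
      intro y
      rw [transition]
      by_cases h1 : y = vertex (r + 2) j
      · rw [if_pos (Or.inl h1), if_pos h1, if_neg (h1 ▸ hne), h1, add_zero,
          ENNReal.ofReal_mul (by positivity)]
      · by_cases h2 : y = vertex r j
        · rw [if_pos (Or.inr h2), if_neg h1, if_pos h2, h2, zero_add,
            ENNReal.ofReal_mul (by positivity)]
        · simp [h1, h2]
    simp_rw [h]
    rw [ENNReal.tsum_add, tsum_ite_eq, tsum_ite_eq, stepMean,
      ← ENNReal.ofReal_add (mul_nonneg (by positivity) (hg _)) (mul_nonneg (by positivity) (hg _))]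
    congr 1
    ring

/-- The trajectory of `S` up to time `n`. -/
def path {Ω : Type*} (S : ℕ → Ω → Spider N) (n : ℕ) (ω : Ω) (k : Fin (n + 1)) : Spider N := S k ω

variable {Ω : Type*} [MeasurableSpace Ω] {μ : Measure Ω} {S : ℕ → Ω → Spider N}

lemma IsWalk.measurable_path {p : Fin N → ℝ} (hS : IsWalk μ p S) (n : ℕ) :
    Measurable (path S n) :=
  measurable_pi_lambda _ fun k => hS.measurable k

variable [IsProbabilityMeasure μ]

lemma IsWalk.measure_path_and_next {p : Fin N → ℝ} (hS : IsWalk μ p S) (n : ℕ)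
    (q : Fin (n + 1) → Spider N) (y : Spider N) :
    μ ((fun ω => (path S n ω, S (n + 1) ω)) ⁻¹' {(q, y)})
      = μ (path S n ⁻¹' {q}) * ENNReal.ofReal (transition p (q (Fin.last n)) y) := by
  -- Only the values up to `n + 1` matter; past the end of `q` the constant `y` serves.
  let x : ℕ → Spider N := fun k => if h : k < n + 1 then q ⟨k, h⟩ else y
  have hx : ∀ k (h : k < n + 1), x k = q ⟨k, h⟩ := fun k h => dif_pos h
  have hxl : x (n + 1) = y := dif_neg (lt_irrefl _)
  have hpath : path S n ⁻¹' {q} = {ω | ∀ k ≤ n, S k ω = x k} := by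
    ext ω
    simp only [Set.mem_preimage, Set.mem_singleton_iff, Set.mem_ofPred_eq, funext_iff, path]
    constructor
    · intro h k hk
      rw [hx k (by omega), ← h]
    · intro h k
      rw [h k (by omega), hx k k.2]
  have hboth : (fun ω => (path S n ω, S (n + 1) ω)) ⁻¹' {(q, y)}
      = {ω | ∀ k ≤ n + 1, S k ω = x k} := by
    ext ω
    have h1 : path S n ω = q ↔ ∀ k ≤ n, S k ω = x k := Set.ext_iff.1 hpath ω
    simp only [Set.mem_preimage, Set.mem_singleton_iff, Set.mem_ofPred_eq, Prod.mk.injEq, h1]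
    constructor
    · rintro ⟨h, h'⟩ k hk
      rcases Nat.le_succ_iff.1 hk with hk | rfl
      · exact h k hk
      · rw [h', ← hxl]
    · intro h
      exact ⟨fun k hk => h k (by omega), by rw [h _ le_rfl, hxl]⟩
  have h := hS.markov n x
  rw [hxl, hx n (Nat.lt_succ_self n), ← hpath, ← hboth] at h
  rw [← ofReal_measureReal, h, ENNReal.ofReal_mul measureReal_nonneg, ofReal_measureReal]
  rfl

/-- `G` may depend on the whole past, because the set of collected legs does. -/
lemma IsWalk.lintegral_next (hS : IsWalk μ (fun _ : Fin N => 1 / (N : ℝ)) S) (n : ℕ)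
    (G : (Fin (n + 1) → Spider N) → Spider N → ℝ) (hG : ∀ q y, 0 ≤ G q y) :
    ∫⁻ ω, ENNReal.ofReal (G (path S n ω) (S (n + 1) ω)) ∂μ
      = ∫⁻ ω, ENNReal.ofReal (stepMean (G (path S n ω)) (S n ω)) ∂μ := by
  have hm := hS.measurable_path n
  have hm' : Measurable fun ω => (path S n ω, S (n + 1) ω) := hm.prodMk (hS.measurable _)
  calc
    _ = ∫⁻ z, ENNReal.ofReal (G z.1 z.2) ∂(μ.map fun ω => (path S n ω, S (n + 1) ω)) :=
        (lintegral_map (f := fun z => ENNReal.ofReal (G z.1 z.2)) .of_discrete hm').symm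
    _ = ∑' q, ∑' y, ENNReal.ofReal (G q y) * (μ (path S n ⁻¹' {q}) *
          ENNReal.ofReal (transition (fun _ : Fin N => 1 / (N : ℝ)) (q (Fin.last n)) y)) := by
        rw [lintegral_countable', ENNReal.tsum_prod']
        refine tsum_congr fun q => tsum_congr fun y => ?_
        rw [Measure.map_apply hm' .of_discrete, hS.measure_path_and_next]
    _ = ∑' q, ENNReal.ofReal (stepMean (G q) (q (Fin.last n))) * μ (path S n ⁻¹' {q}) := by
        refine tsum_congr fun q => ?_
        rw [← tsum_transition_mul _ (hG q), ← ENNReal.tsum_mul_right]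
        refine tsum_congr fun y => ?_
        ring
    _ = ∫⁻ q, ENNReal.ofReal (stepMean (G q) (q (Fin.last n))) ∂(μ.map (path S n)) := by
        rw [lintegral_countable']
        refine tsum_congr fun q => ?_
        rw [Measure.map_apply hm .of_discrete]
    _ = _ := lintegral_map (f := fun q => ENNReal.ofReal (stepMean (G q) (q (Fin.last n))))
        .of_discrete hm

/-! ### Moments of the height -/

lemma IsWalk.lintegral_height_succ (hN : 1 ≤ N)
    (hS : IsWalk μ (fun _ : Fin N => 1 / (N : ℝ)) S) (n : ℕ) :
    ∫⁻ ω, ENNReal.ofReal (height (S (n + 1) ω)) ∂μ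
      = ∫⁻ ω, ENNReal.ofReal (height (S n ω)) ∂μ + μ (S n ⁻¹' {body}) := by
  have hN' : (N : ℝ) ≠ 0 := by positivity
  have hb : MeasurableSet (S n ⁻¹' {body}) := hS.measurable n .of_discrete
  rw [hS.lintegral_next n (fun _ y => height y) (fun _ _ => by positivity),
    ← lintegral_indicator_one hb, ← lintegral_add_right _ (measurable_one.indicator hb)]
  refine lintegral_congr fun ω => ?_
  rcases h : S n ω with _ | ⟨j, r⟩
  · simp [stepMean, Set.indicator, h, hN']
  · simp only [stepMean, height_vertex, height_node, Set.indicator, Set.mem_preimage, h,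
      Set.mem_singleton_iff, reduceCtorEq, if_false, add_zero]
    congr 1
    push_cast
    ring

/-- The height is a reflected simple walk, whose square gains exactly one in mean at every step, the
body included. -/
lemma IsWalk.lintegral_height_sq (hN : 1 ≤ N)
    (hS : IsWalk μ (fun _ : Fin N => 1 / (N : ℝ)) S) (n : ℕ) :
    ∫⁻ ω, ENNReal.ofReal ((height (S n ω) : ℝ) ^ 2) ∂μ = n := by
  have hN' : (N : ℝ) ≠ 0 := by positivity
  induction n with
  | zero =>
    rw [lintegral_congr_ae (g := fun _ => 0) (hS.start.mono fun ω h => by simp [h])]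
    simp
  | succ n ih =>
    rw [hS.lintegral_next n (fun _ y => (height y : ℝ) ^ 2) (fun _ _ => by positivity)]
    have h : ∀ ω, ENNReal.ofReal (stepMean (fun y => (height y : ℝ) ^ 2) (S n ω))
        = ENNReal.ofReal ((height (S n ω) : ℝ) ^ 2) + 1 := by
      intro ω
      rw [← ENNReal.ofReal_one, ← ENNReal.ofReal_add (by positivity) zero_le_one]
      congr 1
      rcases S n ω with _ | ⟨j, r⟩
      · simp [stepMean, hN']
      · simp only [stepMean, height_vertex, height_node]
        push_cast
        ring
    simp_rw [h]
    rw [lintegral_add_right _ measurable_const, ih]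
    simp

lemma IsWalk.lintegral_height_le_sqrt (hN : 1 ≤ N)
    (hS : IsWalk μ (fun _ : Fin N => 1 / (N : ℝ)) S) (n : ℕ) :
    ∫⁻ ω, ENNReal.ofReal (height (S n ω)) ∂μ ≤ ENNReal.ofReal √n := by
  rcases Nat.eq_zero_or_pos n with rfl | hn
  · rw [lintegral_congr_ae (g := fun _ => 0) (hS.start.mono fun ω h => by simp [h])]
    simp
  have hs : 0 < √(n : ℝ) := Real.sqrt_pos.2 (by exact_mod_cast hn)
  have hsq : √(n : ℝ) ^ 2 = n := Real.sq_sqrt (by positivity)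
  calc
    -- AM-GM with weight `√n` replaces Cauchy–Schwarz.
    _ ≤ ∫⁻ ω, ENNReal.ofReal (1 / (2 * √n)) * ENNReal.ofReal ((height (S n ω) : ℝ) ^ 2)
          + ENNReal.ofReal (√n / 2) ∂μ := by
        refine lintegral_mono fun ω => ?_
        rw [← ENNReal.ofReal_mul (by positivity), ← ENNReal.ofReal_add (by positivity)
          (by positivity)]
        refine ENNReal.ofReal_le_ofReal ?_
        have : 1 / (2 * √(n : ℝ)) * (height (S n ω) : ℝ) ^ 2 + √n / 2 - height (S n ω)
            = (height (S n ω) - √n) ^ 2 / (2 * √n) := by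
          field_simp
          ring
        have : 0 ≤ (height (S n ω) - √(n : ℝ)) ^ 2 / (2 * √n) := by positivity
        linarith
    _ = _ := by
        rw [lintegral_add_right _ measurable_const, lintegral_const_mul' _ _ ENNReal.ofReal_ne_top,
          hS.lintegral_height_sq hN, lintegral_const, measure_univ, mul_one,
          ← ENNReal.ofReal_natCast n, ← ENNReal.ofReal_mul (by positivity),
          ← ENNReal.ofReal_add (by positivity) (by positivity)]
        congr 1
        field_simp
        rw [hsq]
        ring

/-! ### Coupon means and the potential -/

/-- The mean number of uniform draws from `N` coupons until `c` different ones have been drawn. -/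
noncomputable def couponMean (N c : ℕ) : ℝ := ∑ i ∈ Finset.range c, (N : ℝ) / ((N : ℝ) - i)

lemma couponMean_nonneg {c : ℕ} (hc : c ≤ N) : 0 ≤ couponMean N c := by
  refine Finset.sum_nonneg fun i hi => div_nonneg (by positivity) ?_
  have : (i : ℝ) ≤ N := by exact_mod_cast (Finset.mem_range.1 hi).le.trans hc
  linarith

lemma couponMean_self (N : ℕ) : couponMean N N = N * harmonic N := by
  rw [couponMean, ← Finset.sum_range_reflect, harmonic, Rat.cast_sum, Finset.mul_sum]
  refine Finset.sum_congr rfl fun i hi => ?_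
  have hi := Finset.mem_range.1 hi
  rw [Nat.sub_sub, Nat.cast_sub (by omega)]
  push_cast
  rw [div_eq_mul_inv]
  congr 2
  ring

/-- Given the position and the set `C` of legs whose vertex at height `L` has been visited:
the coupon mean of `C`, plus its expected growth before the next return to the body. -/
noncomputable def potential (L : ℕ) (C : Finset (Fin N)) : Spider N → ℝ
  | body => couponMean N C.card
  | node j r => couponMean N C.card +
      if j ∈ C then 0 else min (((r + 1 : ℕ) : ℝ) / L) 1 * (N / ((N : ℝ) - C.card))

lemma potential_vertex (L : ℕ) (C : Finset (Fin N)) (r : ℕ) (j : Fin N) :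
    potential L C (vertex r j) = couponMean N C.card +
      if j ∈ C then 0 else min ((r : ℝ) / L) 1 * (N / ((N : ℝ) - C.card)) := by
  cases r with
  | zero => simp [vertex, potential]
  | succ r => rfl

lemma card_le_real (C : Finset (Fin N)) : (C.card : ℝ) ≤ N := by
  exact_mod_cast C.card_le_univ.trans_eq (Fintype.card_fin N)

lemma couponMean_le_potential (L : ℕ) (C : Finset (Fin N)) (x : Spider N) :
    couponMean N C.card ≤ potential L C x := by
  rcases x with _ | ⟨j, r⟩
  · exact le_rfl
  · have : 0 ≤ (N : ℝ) - C.card := sub_nonneg.2 (card_le_real C)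
    rw [potential, le_add_iff_nonneg_right]
    split_ifs <;> positivity

lemma potential_nonneg (L : ℕ) (C : Finset (Fin N)) (x : Spider N) : 0 ≤ potential L C x :=
  (couponMean_nonneg (by simpa using C.card_le_univ)).trans (couponMean_le_potential L C x)

open Classical in
/-- The set of visited legs after a step to `x`. -/
noncomputable def addVisited (L : ℕ) (C : Finset (Fin N)) (x : Spider N) : Finset (Fin N) :=
  C ∪ Finset.univ.filter fun j => x = vertex L j

lemma vertex_inj {L : ℕ} (hL : 1 ≤ L) {i j : Fin N} : vertex L i = vertex L j ↔ i = j := by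
  obtain ⟨L, rfl⟩ := Nat.exists_eq_add_of_le' hL
  simp [vertex]

/-- At height `L` the excursion term has grown to `N / (N - C.card)`, exactly the next summand of
the coupon mean, so collecting the leg only moves this amount from one term to the other. -/
lemma potential_addVisited {L : ℕ} (hL : 1 ≤ L) (C : Finset (Fin N)) (x : Spider N) :
    potential L (addVisited L C x) x = potential L C x := by
  classical
  by_cases hx : ∃ j, x = vertex L j
  · obtain ⟨j, rfl⟩ := hx
    have hC : addVisited L C (vertex L j) = insert j C := by
      ext i
      simp [addVisited, vertex_inj hL, or_comm, eq_comm]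
    rw [hC]
    by_cases hj : j ∈ C
    · rw [Finset.insert_eq_of_mem hj]
    · have hL' : (L : ℝ) ≠ 0 := by positivity
      rw [potential_vertex, potential_vertex, if_pos (Finset.mem_insert_self _ _), if_neg hj,
        Finset.card_insert_of_notMem hj, couponMean, Finset.sum_range_succ, div_self hL']
      simp [couponMean]
  · have : addVisited L C x = C := by
      ext i
      have : x ≠ vertex L i := fun h => hx ⟨i, h⟩
      simp [addVisited, this]
    rw [this]

/-- From the body, an uncollected leg is entered with probability `(N - C.card) / N`, which cancels
the factor `N / (N - C.card)`. On a leg, `min (r / L) 1` is concave in `r`. -/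
lemma stepMean_potential_le (hN : 1 ≤ N) {L : ℕ} (hL : 1 ≤ L) (C : Finset (Fin N))
    (x : Spider N) :
    stepMean (potential L C) x ≤ potential L C x + if x = body then 1 / (L : ℝ) else 0 := by
  have hN' : (0 : ℝ) < N := by positivity
  have hL' : (1 : ℝ) ≤ L := by exact_mod_cast hL
  have hc : 0 ≤ (N : ℝ) - C.card := sub_nonneg.2 (card_le_real C)
  rcases x with _ | ⟨j, r⟩
  · have hm : min (((1 : ℕ) : ℝ) / L) 1 = 1 / L := by
      rw [Nat.cast_one, min_eq_left ((div_le_one (by positivity)).2 hL')]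
    simp only [stepMean, potential_vertex, hm, if_true, ← Finset.mul_sum,
      Finset.sum_add_distrib]
    rw [potential]
    have hs : ∑ j : Fin N, (if j ∈ C then (0 : ℝ) else 1 / L * (N / ((N : ℝ) - C.card)))
        = ((N : ℝ) - C.card) * (1 / L * (N / ((N : ℝ) - C.card))) := by
      classical
      rw [Finset.sum_ite, Finset.sum_const_zero, zero_add, Finset.sum_const, nsmul_eq_mul]
      congr 1
      have : Finset.univ.filter (fun j => j ∉ C) = Cᶜ := by ext; simp
      rw [this, Finset.card_compl, Fintype.card_fin,
        Nat.cast_sub (by simpa using C.card_le_univ)]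
    rw [hs]
    simp only [Finset.sum_const, Finset.card_univ, Fintype.card_fin, nsmul_eq_mul]
    rw [mul_add, ← mul_assoc, one_div_mul_cancel hN'.ne', one_mul]
    gcongr
    -- With all legs collected the left side vanishes; otherwise equality holds.
    rcases hc.eq_or_lt with h | h
    · rw [← h]
      simp
    · exact le_of_eq (by field_simp)
  · simp only [stepMean, ← vertex_succ, potential_vertex]
    simp only [vertex_succ, reduceCtorEq, if_false, add_zero]
    split_ifs
    · linarith
    · have ha : 0 ≤ N / ((N : ℝ) - C.card) := by positivity
      have hmin : min (((r + 2 : ℕ) : ℝ) / L) 1 + min ((r : ℝ) / L) 1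
          ≤ 2 * min (((r + 1 : ℕ) : ℝ) / L) 1 := by
        have h2 : ((r + 2 : ℕ) : ℝ) / L + (r : ℝ) / L = 2 * (((r + 1 : ℕ) : ℝ) / L) := by
          push_cast
          ring
        rcases min_choice (((r + 1 : ℕ) : ℝ) / L) 1 with h | h <;> rw [h]
        · have := min_le_left (((r + 2 : ℕ) : ℝ) / L) 1
          have := min_le_left ((r : ℝ) / L) 1
          linarith
        · have := min_le_right (((r + 2 : ℕ) : ℝ) / L) 1
          have := min_le_right ((r : ℝ) / L) 1
          linarith
      nlinarith [mul_le_mul_of_nonneg_right hmin ha]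

/-! ### Collected legs and the growth of the potential -/

open Classical in
/-- The legs whose vertex at height `L` lies on the trajectory `q`. -/
noncomputable def visited (L : ℕ) {n : ℕ} (q : Fin (n + 1) → Spider N) : Finset (Fin N) :=
  Finset.univ.filter fun j => ∃ k, q k = vertex L j

lemma mem_visited {L n : ℕ} {q : Fin (n + 1) → Spider N} {j : Fin N} :
    j ∈ visited L q ↔ ∃ k, q k = vertex L j := by
  simp [visited]

lemma visited_path_succ {Ω : Type*} {S : ℕ → Ω → Spider N} (L n : ℕ)
    (ω : Ω) :
    visited L (path S (n + 1) ω) = addVisited L (visited L (path S n ω)) (S (n + 1) ω) := by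
  ext j
  simp only [addVisited, mem_visited, Finset.mem_filter, Finset.mem_univ, true_and,
    Finset.mem_union]
  exact Fin.exists_fin_succ'

lemma visited_path_zero {Ω : Type*} {S : ℕ → Ω → Spider N} {L : ℕ} (hL : 1 ≤ L) {ω : Ω}
    (h : S 0 ω = body) :
    visited L (path S 0 ω) = ∅ := by
  obtain ⟨L, rfl⟩ := Nat.exists_eq_add_of_le' hL
  ext j
  simp [visited, path, h, vertex]

/-- Both sides start at zero, and each visit to the body adds at most `1 / L` on the left and
exactly that on the right. -/
lemma IsWalk.lintegral_potential_le (hN : 1 ≤ N)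
    (hS : IsWalk μ (fun _ : Fin N => 1 / (N : ℝ)) S) {L : ℕ} (hL : 1 ≤ L) (n : ℕ) :
    ∫⁻ ω, ENNReal.ofReal (potential L (visited L (path S n ω)) (S n ω)) ∂μ
      ≤ ENNReal.ofReal (1 / L) * ∫⁻ ω, ENNReal.ofReal (height (S n ω)) ∂μ := by
  induction n with
  | zero =>
    rw [lintegral_congr_ae (g := fun _ => 0) (hS.start.mono fun ω h => by
      simp [visited_path_zero hL h, h, potential, couponMean])]
    simp
  | succ n ih =>
    have hb : MeasurableSet (S n ⁻¹' {body}) := hS.measurable n .of_discrete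
    calc
      _ = ∫⁻ ω, ENNReal.ofReal (potential L (visited L (path S n ω)) (S (n + 1) ω)) ∂μ := by
          simp_rw [visited_path_succ, potential_addVisited hL]
      _ = ∫⁻ ω, ENNReal.ofReal
            (stepMean (potential L (visited L (path S n ω))) (S n ω)) ∂μ :=
          hS.lintegral_next n (fun q => potential L (visited L q))
            (fun _ _ => potential_nonneg _ _ _)
      _ ≤ ∫⁻ ω, ENNReal.ofReal (potential L (visited L (path S n ω)) (S n ω))
            + (S n ⁻¹' {body}).indicator (fun _ => ENNReal.ofReal (1 / L)) ω ∂μ := by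
          refine lintegral_mono fun ω => ?_
          refine (ENNReal.ofReal_le_ofReal (stepMean_potential_le hN hL _ _)).trans ?_
          rw [ENNReal.ofReal_add (potential_nonneg _ _ _) (by split_ifs <;> positivity)]
          by_cases h : S n ω = body <;> simp [Set.indicator, h]
      _ = ∫⁻ ω, ENNReal.ofReal (potential L (visited L (path S n ω)) (S n ω)) ∂μ
            + ENNReal.ofReal (1 / L) * μ (S n ⁻¹' {body}) := by
          rw [lintegral_add_right _ (measurable_const.indicator hb), lintegral_indicator_const hb]
      _ ≤ _ := by
          rw [hS.lintegral_height_succ hN, mul_add]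
          gcongr

lemma reachAll_iff_visited {Ω : Type*} {S : ℕ → Ω → Spider N} (n L : ℕ)
    (ω : Ω) :
    ω ∈ reachAll S n L ↔ visited L (path S n ω) = Finset.univ := by
  simp only [reachAll, Set.mem_ofPred_eq, localTime, Nat.one_le_iff_ne_zero, Finset.card_ne_zero,
    Finset.eq_univ_iff_forall, mem_visited, path]
  refine forall_congr' fun j => ⟨?_, ?_⟩
  · rintro ⟨k, hk⟩
    rw [Finset.mem_filter, Finset.mem_range] at hk
    exact ⟨⟨k, hk.1⟩, hk.2⟩
  · rintro ⟨k, hk⟩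
    exact ⟨k, Finset.mem_filter.2 ⟨Finset.mem_range.2 k.2, hk⟩⟩

/-- The probability of reaching height `L` on all legs in `n` steps, times the mean coupon
collector time, is at most `√n / L`. -/
lemma IsWalk.mul_measureReal_reachAll_le (hN : 1 ≤ N)
    (hS : IsWalk μ (fun _ : Fin N => 1 / (N : ℝ)) S) {L : ℕ} (hL : 1 ≤ L) (n : ℕ) :
    N * harmonic N * μ.real (reachAll S n L) ≤ 1 / L * √n := by
  have hH : (0 : ℝ) ≤ N * harmonic N := by
    rw [← couponMean_self]
    exact couponMean_nonneg le_rfl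
  have hm : Measurable fun ω =>
      ENNReal.ofReal (potential L (visited L (path S n ω)) (S n ω)) :=
    (Measurable.of_discrete (f := fun q : Fin (n + 1) → Spider N =>
      ENNReal.ofReal (potential L (visited L q) (q (Fin.last n))))).comp (hS.measurable_path n)
  rw [← ENNReal.ofReal_le_ofReal_iff (by positivity), ENNReal.ofReal_mul hH, ofReal_measureReal]
  calc
    _ ≤ ENNReal.ofReal (N * harmonic N) * μ {ω | ENNReal.ofReal (N * harmonic N)
          ≤ ENNReal.ofReal (potential L (visited L (path S n ω)) (S n ω))} := by
        gcongr
        intro ω hω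
        have := couponMean_le_potential L (visited L (path S n ω)) (S n ω)
        rw [(reachAll_iff_visited n L ω).1 hω, Finset.card_univ, Fintype.card_fin,
          couponMean_self] at this
        rw [Set.mem_ofPred_eq, (reachAll_iff_visited n L ω).1 hω]
        exact ENNReal.ofReal_le_ofReal this
    _ ≤ _ := mul_meas_ge_le_lintegral hm _
    _ ≤ _ := hS.lintegral_potential_le hN hL n
    _ ≤ _ := by
        rw [ENNReal.ofReal_mul (by positivity)]
        gcongr
        exact hS.lintegral_height_le_sqrt hN n

end Spider

/-! ### The limit -/

theorem theorem5p4
    (Ω : ℕ → Type*) [∀ N, MeasurableSpace (Ω N)]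
    (P : ∀ N, Measure (Ω N)) [∀ N, IsProbabilityMeasure (P N)]
    (S : ∀ N, ℕ → Ω N → Spider N)
    (hS : ∀ N, 1 ≤ N → Spider.IsWalk (P N) (fun _ : Fin N => 1 / (N : ℝ)) (S N))
    (L : ℕ → ℕ)
    (hL : ∀ᶠ N : ℕ in atTop, 1 ≤ L N ∧ (L N : ℝ) ≤ N / Real.log N)
    (f : ℕ → ℝ) (hf : Antitone f) (hf0 : Tendsto f atTop (𝓝 0)) :
    Tendsto
      (fun N : ℕ => (P N).real
        (Spider.reachAll (S N) ⌊(f N * (L N : ℝ) * (N : ℝ) * Real.log N) ^ 2⌋₊ (L N)))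
      atTop (𝓝 0) := by
  refine squeeze_zero' (Eventually.of_forall fun _ => measureReal_nonneg) ?_ hf0
  filter_upwards [hL, eventually_ge_atTop 1] with N hLN hN
  have hfN : 0 ≤ f N := hf.le_of_tendsto hf0 N
  have hN' : (0 : ℝ) < N := by exact_mod_cast hN
  have hL' : (0 : ℝ) < L N := by exact_mod_cast hLN.1
  have hlog : 0 ≤ Real.log N := Real.log_natCast_nonneg N
  have hH : Real.log N ≤ harmonic N :=
    (Real.log_le_log hN' (by push_cast; linarith)).trans (log_add_one_le_harmonic N)
  have hH0 : (0 : ℝ) < harmonic N := by exact_mod_cast harmonic_pos (by omega)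
  have hsqrt : √(⌊(f N * (L N : ℝ) * (N : ℝ) * Real.log N) ^ 2⌋₊ : ℝ)
      ≤ f N * L N * N * Real.log N :=
    Real.sqrt_le_iff.2 ⟨by positivity, Nat.floor_le (by positivity)⟩
  -- It remains to compare after multiplying by `N * harmonic N`; the surplus factor `log N /
  -- harmonic N` is at most one.
  refine le_of_mul_le_mul_left ?_ (mul_pos hN' hH0)
  calc
    _ ≤ 1 / (L N : ℝ) * √(⌊(f N * (L N : ℝ) * (N : ℝ) * Real.log N) ^ 2⌋₊ : ℝ) :=
        (hS N hN).mul_measureReal_reachAll_le hN hLN.1 _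
    _ ≤ 1 / (L N : ℝ) * (f N * L N * N * Real.log N) := by gcongr
    _ = N * Real.log N * f N := by field_simp
    _ ≤ _ := by gcongr
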